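/- Let $\Omega\subseteq\mathbb{C}$ be a simply connected open set, that is, an open set each of whose connected components is simply connected (in particular, $\Omega$ may be any simply connected domain), and let $\zeta_0\in\Omega$. Let $\mathcal{F}\subseteq\mathbb{N}\times\mathbb{N}$, where $\mathbb{N}=\{0,1,2,\dots\}$, contain a sequence $(\tilde p_n,\tilde q_n)_{n}$ with $\tilde p_n\to+\infty$. Let $H(\Omega)$ be the space of holomorphic functions on $\Omega$ with the topology of uniform convergence on compact subsets of $\Omega$. For $f\in H(\Omega)$ put $a_v=f^{(v)}(\zeta_0)/v!$ for $v\ge 0$ and $a_v=0$ for $v<0$. Write $f\in\mathcal{D}_{p,q}(\zeta_0)$ if the Hankel determinant $\det\left(a_{p-q+1+i+j}\right)_{0\le i,j\le q-1}$ is nonzero (for $q=0$ the empty determinant is $1$, so the condition always holds). If $f\in\mathcal{D}_{p,q}(\zeta_0)$, there is a unique pair of polynomials $N,Q$ with $\deg N\le p$, $\deg Q\le q$ and $Q(0)=1$ such that the Taylor coefficients at $\zeta_0$ of orders $0,\dots,p+q$ of $N(z-\zeta_0)/Q(z-\zeta_0)$ are $a_0,\dots,a_{p+q}$; the Padé approximant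 is $[p/q]_{f,\zeta_0}(z)=N(z-\zeta_0)/Q(z-\zeta_0)$. Theorem 3.6. Consider the set of all $f\in H(\Omega)$ for which there is a sequence $(p_n,q_n)_n$ in $\mathcal{F}$ such that $f\in\mathcal{D}_{p_n,q_n}(\zeta_0)$ for all $n$ and, for every compact set $K\subseteq\Omega$, $$\sup_{z\in K}\left|[p_n/q_n]_{f,\zeta_0}(z)-f(z)\right|\to 0\qquad (n\to+\infty),$$ where the supremum is $+\infty$ if $[p_n/q_n]_{f,\zeta_0}$ has a pole in $K$ (so that for large $n$ there is no pole in $K$). This set is non-empty, and it is a $G_\delta$ and dense subset of $H(\Omega)$. -/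

import Mathlib

open Filter Topology Polynomial

noncomputable section

namespace Pade

/-- The extension by zero to all of `ℂ` of a function on `Ω`; for open `Ω`, derivatives at points
of `Ω` do not depend on the values chosen off `Ω`. -/
def zeroExt {Ω : Set ℂ} (f : C(Ω, ℂ)) : ℂ → ℂ :=
  open Classical in fun z => if h : z ∈ Ω then f ⟨z, h⟩ else 0

/-- `H(Ω)`, the holomorphic functions on the open set `Ω`. As a subspace of `C(Ω, ℂ)` with the
compact-open topology it carries the topology of uniform convergence on compact subsets. -/
def H (Ω : Set ℂ) : Set C(Ω, ℂ) := {f | DifferentiableOn ℂ (zeroExt f) Ω}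

/-- The `v`-th Taylor coefficient at `ζ`. -/
def taylorCoeff {Ω : Set ℂ} (f : H Ω) (ζ : ℂ) (v : ℕ) : ℂ :=
  iteratedDeriv v (zeroExt f.1) ζ / (v.factorial : ℂ)

/-- The Hankel matrix with entries `a_{p-q+1+i+j}` for `0 ≤ i, j < q`, where `a_k = 0` for `k < 0`.
For `q = 0` it is the empty matrix, with determinant `1`. -/
def hankel (a : ℕ → ℂ) (p q : ℕ) : Matrix (Fin q) (Fin q) ℂ :=
  Matrix.of fun i j =>
    if 0 ≤ (p : ℤ) - q + 1 + i + j then a ((p : ℤ) - q + 1 + i + j).toNat else 0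

/-- The class `𝒟_{p,q}(ζ)`: the Hankel determinant of the Taylor coefficients at `ζ` is nonzero. -/
def D {Ω : Set ℂ} (p q : ℕ) (ζ : ℂ) : Set (H Ω) :=
  {f | (hankel (taylorCoeff f ζ) p q).det ≠ 0}

/-- `N(z - ζ) / Q(z - ζ)` is a `[p/q]` Padé approximant of `∑ a_v (z - ζ)^v`: it has
`deg N ≤ p`, `deg Q ≤ q`, `Q(0) = 1`, and the Taylor series of the quotient agrees with the given
series in the terms of order `0, …, p + q`. -/
structure IsPade (a : ℕ → ℂ) (p q : ℕ) (N Q : ℂ[X]) : Prop where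
  natDegree_num : N.natDegree ≤ p
  natDegree_den : Q.natDegree ≤ q
  den_zero : Q.coeff 0 = 1
  taylor : ∀ v ≤ p + q, PowerSeries.coeff v ((N : PowerSeries ℂ) * (Q : PowerSeries ℂ)⁻¹) = a v

theorem isPade_taylor_iff (a : ℕ → ℂ) (m : ℕ) (N Q : ℂ[X]) (hQ : Q.coeff 0 = 1) :
    (∀ v ≤ m, PowerSeries.coeff v ((N : PowerSeries ℂ) * (Q : PowerSeries ℂ)⁻¹) = a v) ↔
      ∀ v ≤ m, PowerSeries.coeff v ((Q : PowerSeries ℂ) * PowerSeries.mk a) = N.coeff v := by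
  have hc : PowerSeries.constantCoeff (Q : PowerSeries ℂ) ≠ 0 := by
    rw [← PowerSeries.coeff_zero_eq_constantCoeff_apply, Polynomial.coeff_coe, hQ]
    exact one_ne_zero
  have hinv : (Q : PowerSeries ℂ) * (Q : PowerSeries ℂ)⁻¹ = 1 := PowerSeries.mul_inv_cancel _ hc
  have h1 : (∀ v ≤ m, PowerSeries.coeff v ((N : PowerSeries ℂ) * (Q : PowerSeries ℂ)⁻¹) = a v) ↔
      PowerSeries.X ^ (m + 1) ∣ (N : PowerSeries ℂ) * (Q : PowerSeries ℂ)⁻¹ - PowerSeries.mk a := by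
    rw [PowerSeries.X_pow_dvd_iff]
    simp only [map_sub, PowerSeries.coeff_mk, sub_eq_zero, Nat.lt_succ_iff]
  have h2 : (∀ v ≤ m, PowerSeries.coeff v ((Q : PowerSeries ℂ) * PowerSeries.mk a) = N.coeff v) ↔
      PowerSeries.X ^ (m + 1) ∣ (N : PowerSeries ℂ) - (Q : PowerSeries ℂ) * PowerSeries.mk a := by
    rw [PowerSeries.X_pow_dvd_iff]
    simp only [map_sub, Polynomial.coeff_coe, sub_eq_zero, Nat.lt_succ_iff]
    exact ⟨fun h v hv => (h v hv).symm, fun h v hv => (h v hv).symm⟩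
  rw [h1, h2]
  constructor
  · intro h
    have := h.mul_left (Q : PowerSeries ℂ)
    rwa [mul_sub, mul_left_comm, hinv, mul_one] at this
  · intro h
    have := h.mul_left ((Q : PowerSeries ℂ)⁻¹)
    rwa [mul_sub, ← mul_assoc, mul_comm _ (Q : PowerSeries ℂ), hinv, one_mul, mul_comm] at this

theorem coeff_den_mul (a : ℕ → ℂ) (p q : ℕ) (Q : ℂ[X]) (hQ : Q.natDegree ≤ q) (i : Fin q) :
    PowerSeries.coeff (p + 1 + i) ((Q : PowerSeries ℂ) * PowerSeries.mk a) =
      Q.coeff 0 * a (p + 1 + i) +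
        (hankel a p q).mulVec (fun j : Fin q => Q.coeff (q - j)) i := by
  have hbig : PowerSeries.coeff (p + 1 + i) ((Q : PowerSeries ℂ) * PowerSeries.mk a) =
      ∑ l ∈ Finset.range (q + 1), Q.coeff l * (if l ≤ p + 1 + i then a (p + 1 + i - l) else 0) := by
    rw [PowerSeries.coeff_mul, Finset.Nat.sum_antidiagonal_eq_sum_range_succ_mk]
    simp only [Polynomial.coeff_coe, PowerSeries.coeff_mk]
    have e1 : ∑ l ∈ Finset.range (p + 1 + i).succ, Q.coeff l * a (p + 1 + i - l) =
        ∑ l ∈ Finset.range (p + 1 + i + 1 + (q + 1)),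
          Q.coeff l * (if l ≤ p + 1 + i then a (p + 1 + i - l) else 0) := by
      trans ∑ l ∈ Finset.range (p + 1 + i + 1),
          Q.coeff l * (if l ≤ p + 1 + i then a (p + 1 + i - l) else 0)
      · refine Finset.sum_congr rfl fun l hl => ?_
        rw [if_pos (by simpa [Nat.lt_succ_iff] using hl)]
      · refine Finset.sum_subset (Finset.range_mono (by omega)) fun l _ hl => ?_
        rw [if_neg (by simpa [Nat.lt_succ_iff] using hl), mul_zero]
    rw [e1]
    symm
    refine Finset.sum_subset (Finset.range_mono (by omega)) fun l _ hl => ?_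
    rw [Polynomial.coeff_eq_zero_of_natDegree_lt, zero_mul]
    simp only [Finset.mem_range, not_lt] at hl
    omega
  rw [hbig, Finset.sum_range_succ', add_comm]
  congr 1
  rw [← Finset.sum_range_reflect, Finset.sum_range, Matrix.mulVec, dotProduct]
  refine Finset.sum_congr rfl fun j _ => ?_
  have hj := j.2
  have e2 : q - 1 - (j : ℕ) + 1 = q - j := by omega
  rw [e2, mul_comm, hankel, Matrix.of_apply]
  congr 1
  by_cases h : q - (j : ℕ) ≤ p + 1 + i
  · rw [if_pos h, if_pos (by omega)]
    congr 1
    omega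
  · rw [if_neg h, if_neg (by omega)]

theorem IsPade.den_eq {a : ℕ → ℂ} {p q : ℕ} {N Q N' Q' : ℂ[X]}
    (hdet : (hankel a p q).det ≠ 0) (h : IsPade a p q N Q) (h' : IsPade a p q N' Q') :
    Q = Q' := by
  have key : ∀ {M R : ℂ[X]}, IsPade a p q M R → ∀ i : Fin q,
      (hankel a p q).mulVec (fun j : Fin q => R.coeff (q - j)) i = - a (p + 1 + i) := by
    intro M R hR i
    have h1 := (isPade_taylor_iff a (p + q) M R hR.den_zero).1 hR.taylor (p + 1 + i) (by omega)
    rw [coeff_den_mul a p q R hR.natDegree_den i, hR.den_zero, one_mul,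
      Polynomial.coeff_eq_zero_of_natDegree_lt
        (lt_of_le_of_lt hR.natDegree_num (by omega))] at h1
    linear_combination h1
  have hv : (fun j : Fin q => Q.coeff (q - j)) = fun j : Fin q => Q'.coeff (q - j) := by
    apply Matrix.mulVec_injective_of_isUnit
      ((Matrix.isUnit_iff_isUnit_det _).2 (isUnit_iff_ne_zero.2 hdet))
    funext i
    rw [key h i, key h' i]
  ext l
  rcases Nat.eq_zero_or_pos l with rfl | hl
  · rw [h.den_zero, h'.den_zero]
  · by_cases hlq : l ≤ q
    · have := congrFun hv ⟨q - l, by omega⟩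
      simpa [Nat.sub_sub_self hlq] using this
    · rw [Polynomial.coeff_eq_zero_of_natDegree_lt (lt_of_le_of_lt h.natDegree_den (by omega)),
        Polynomial.coeff_eq_zero_of_natDegree_lt (lt_of_le_of_lt h'.natDegree_den (by omega))]

theorem IsPade.num_eq {a : ℕ → ℂ} {p q : ℕ} {N Q N' Q' : ℂ[X]}
    (hdet : (hankel a p q).det ≠ 0) (h : IsPade a p q N Q) (h' : IsPade a p q N' Q') :
    N = N' := by
  have hQ := h.den_eq hdet h'
  subst hQ
  ext l
  by_cases hl : l ≤ p
  · rw [← (isPade_taylor_iff a (p + q) N Q h.den_zero).1 h.taylor l (by omega),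
      ← (isPade_taylor_iff a (p + q) N' Q h.den_zero).1 h'.taylor l (by omega)]
  · rw [Polynomial.coeff_eq_zero_of_natDegree_lt (lt_of_le_of_lt h.natDegree_num (by omega)),
      Polynomial.coeff_eq_zero_of_natDegree_lt (lt_of_le_of_lt h'.natDegree_num (by omega))]

theorem exists_isPade {a : ℕ → ℂ} {p q : ℕ} (hdet : (hankel a p q).det ≠ 0) :
    ∃ N Q : ℂ[X], IsPade a p q N Q := by
  obtain ⟨y, hy⟩ := (Matrix.mulVec_surjective_iff_isUnit.2
    ((Matrix.isUnit_iff_isUnit_det _).2 (isUnit_iff_ne_zero.2 hdet)))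
      (fun i : Fin q => - a (p + 1 + i))
  let c : ℕ → ℂ := fun l => if l = 0 then 1 else if h : q - l < q then y ⟨q - l, h⟩ else 0
  let Q : ℂ[X] := ∑ l ∈ Finset.range (q + 1), Polynomial.monomial l (c l)
  have hcoeff : ∀ l, Q.coeff l = if l < q + 1 then c l else 0 := by
    intro l
    simp [Q, Polynomial.coeff_monomial]
  have hQ0 : Q.coeff 0 = 1 := by rw [hcoeff]; simp [c]
  have hQd : Q.natDegree ≤ q := by
    rw [Polynomial.natDegree_le_iff_coeff_eq_zero]
    intro l hl
    rw [hcoeff, if_neg (by omega)]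
  have hQy : (fun j : Fin q => Q.coeff (q - j)) = y := by
    funext j
    have hj := j.2
    have e : q - (q - (j : ℕ)) = j := by omega
    rw [hcoeff, if_pos (by omega)]
    simp only [c]
    rw [if_neg (by omega), dif_pos (by omega)]
    congr 1
    exact Fin.ext e
  let N : ℂ[X] := PowerSeries.trunc (p + 1) ((Q : PowerSeries ℂ) * PowerSeries.mk a)
  have hNd : N.natDegree ≤ p := by
    rw [Polynomial.natDegree_le_iff_coeff_eq_zero]
    intro l hl
    rw [PowerSeries.coeff_trunc, if_neg (by omega)]
  refine ⟨N, Q, hNd, hQd, hQ0, (isPade_taylor_iff a (p + q) N Q hQ0).2 fun v hv => ?_⟩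
  rw [PowerSeries.coeff_trunc]
  by_cases hvp : v < p + 1
  · rw [if_pos hvp]
  · obtain ⟨i, rfl⟩ : ∃ i, v = p + 1 + i := ⟨v - (p + 1), by omega⟩
    rw [if_neg hvp]
    have := coeff_den_mul a p q Q hQd ⟨i, by omega⟩
    simp only [hQy, hQ0] at this
    rw [this, hy]
    ring

/-- A nonzero Hankel determinant gives exactly one Padé approximant in normalized form. -/
theorem existsUnique_isPade {a : ℕ → ℂ} {p q : ℕ} (hdet : (hankel a p q).det ≠ 0) :
    ∃! R : ℂ[X] × ℂ[X], IsPade a p q R.1 R.2 := by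
  obtain ⟨N, Q, h⟩ := exists_isPade hdet
  exact ⟨(N, Q), h, fun R hR => Prod.ext (hR.num_eq hdet h) (hR.den_eq hdet h)⟩

open Classical in
/-- Numerator and denominator of `[p/q]_{f,ζ}` as polynomials in `z - ζ`. The definition is used
only for `f ∈ D p q ζ`, where they exist and are unique; the value in other cases is arbitrary. -/
def padePair {Ω : Set ℂ} (f : H Ω) (ζ : ℂ) (p q : ℕ) : ℂ[X] × ℂ[X] :=
  if h : ∃ R : ℂ[X] × ℂ[X], IsPade (taylorCoeff f ζ) p q R.1 R.2 then h.choose else (0, 1)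

theorem padePair_isPade {Ω : Set ℂ} {f : H Ω} {ζ : ℂ} {p q : ℕ} (hf : f ∈ D p q ζ) :
    IsPade (taylorCoeff f ζ) p q (padePair f ζ p q).1 (padePair f ζ p q).2 := by
  have h : ∃ R : ℂ[X] × ℂ[X], IsPade (taylorCoeff f ζ) p q R.1 R.2 :=
    (existsUnique_isPade hf).exists
  rw [padePair, dif_pos h]
  exact h.choose_spec

/-- The denominator of `[p/q]_{f,ζ}` at `z`. For `f ∈ D p q ζ` numerator and denominator have no
common zero (cancelling a common factor would give a second normalized pair), so that the zeros of
the denominator are exactly the poles. -/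
def padeDen {Ω : Set ℂ} (f : H Ω) (ζ : ℂ) (p q : ℕ) (z : ℂ) : ℂ :=
  (padePair f ζ p q).2.eval (z - ζ)

/-- The value `[p/q]_{f,ζ}(z)` at a point `z` that is not a pole. -/
def pade {Ω : Set ℂ} (f : H Ω) (ζ : ℂ) (p q : ℕ) (z : ℂ) : ℂ :=
  (padePair f ζ p q).1.eval (z - ζ) / padeDen f ζ p q z

/-- The functions `f ∈ H(Ω)` for which one sequence `(p_n, q_n)` in `F` satisfies
`f ∈ 𝒟_{p_n,q_n}(ζ)` for all `n` and `sup_K |[p_n/q_n]_{f,ζ} - f| → 0` for every compact `K ⊆ Ω`.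
The supremum is infinite when there is a pole on `K`, so its convergence to `0` says that there is
no pole on `K` for large `n` and that the convergence is uniform on `K`. -/
def padeLimits (Ω : Set ℂ) (F : Set (ℕ × ℕ)) (ζ : ℂ) : Set (H Ω) :=
  {f | ∃ p q : ℕ → ℕ, (∀ n, (p n, q n) ∈ F) ∧ (∀ n, f ∈ D (p n) (q n) ζ) ∧
    ∀ K : Set ℂ, K ⊆ Ω → IsCompact K →
      (∀ᶠ n in atTop, ∀ z ∈ K, padeDen f ζ (p n) (q n) z ≠ 0) ∧
      TendstoUniformlyOn (fun n => pade f ζ (p n) (q n)) (zeroExt f.1) atTop K}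

end Pade

end

/-! A polynomial of exact degree `p` has nonzero Hankel determinant for every `(p, q)` and is its
own `[p/q]` approximant, so it lies in the set if some `(p, q)` is in `F`. A small multiple of `z ^
p` gives any polynomial of lower degree such a degree; as `F` has arbitrarily large `p`, density
reduces to density of polynomials, which is Runge's theorem. The set is `Gδ` because Padé
coefficients depend continuously on finitely many Taylor coefficients where the Hankel determinant
is nonzero (`isOpen_setOf_pade_near`, `padeLimits_eq_iInter`).

Runge's theorem comes from the Banach algebra `V` of uniform limits of polynomials on `K`. The
spectrum in `V` of the coordinate only fills holes of `K`. Logarithms and the Cauchy–Pompeiu formula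
show that `Ωᶜ` has no compact part separated from the rest, so the spectrum stays in `Ω`; a
Cauchy–Pompeiu integral of resolvents then puts `f` in `V`. -/

/-! ### The Cauchy–Pompeiu formula -/

/-- Twice the Wirtinger derivative `∂φ/∂z̄`. -/
noncomputable def dbar (φ : ℂ → ℂ) (z : ℂ) : ℂ :=
  fderiv ℝ φ z 1 + Complex.I * fderiv ℝ φ z Complex.I

theorem continuous_dbar {φ : ℂ → ℂ} (hφ : ContDiff ℝ 1 φ) : Continuous (dbar φ) := by
  have := hφ.continuous_fderiv one_ne_zero
  unfold dbar
  fun_prop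

theorem dbar_eq_zero_of_differentiableAt {f : ℂ → ℂ} {z : ℂ} (hf : DifferentiableAt ℂ f z) :
    dbar f z = 0 := by
  have h := (hf.hasDerivAt.hasFDerivAt.restrictScalars ℝ).fderiv
  simp only [dbar, h, ContinuousLinearMap.coe_restrictScalars',
    ContinuousLinearMap.toSpanSingleton_apply, smul_eq_mul]
  linear_combination (deriv f z) * Complex.I_mul_I

theorem dbar_congr {f g : ℂ → ℂ} {z : ℂ} (h : f =ᶠ[𝓝 z] g) : dbar f z = dbar g z := by
  simp only [dbar, h.fderiv_eq]

theorem tsupport_dbar_subset (φ : ℂ → ℂ) : tsupport (dbar φ) ⊆ tsupport φ := by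
  refine closure_minimal (fun z hz => ?_) (isClosed_tsupport φ)
  by_contra h
  refine hz ?_
  rw [dbar_congr (notMem_tsupport_iff_eventuallyEq.1 h)]
  exact dbar_eq_zero_of_differentiableAt (differentiableAt_const 0)

/-- Passes from the frame `1, I` to the polar frame `e, I * e` when `e` is unimodular. -/
theorem apply_add_I_mul_apply_I_mul (D : ℂ →L[ℝ] ℂ) (e : ℂ) :
    D e + Complex.I * D (Complex.I * e) = (D 1 + Complex.I * D Complex.I) * starRingEnd ℂ e := by
  have key : ∀ w : ℂ, D w = w.re * D 1 + w.im * D Complex.I := by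
    intro w
    conv_lhs => rw [show w = w.re • (1 : ℂ) + w.im • Complex.I by simp [Complex.re_add_im]]
    rw [map_add, map_smul, map_smul, Complex.real_smul, Complex.real_smul]
  have hconj : starRingEnd ℂ e = e.re - e.im * Complex.I := by
    apply Complex.ext <;> simp
  rw [key e, key (Complex.I * e), hconj]
  simp only [Complex.mul_re, Complex.mul_im, Complex.I_re, Complex.I_im]
  push_cast
  linear_combination (e.im : ℂ) * D Complex.I * Complex.I_mul_I

-- In polar coordinates the Jacobian `r` cancels `‖w⁻¹‖`, leaving the radial derivative `u` plus `I
-- * v`. Each ray contributes `-φ 0` through `u`, and `r * v` is the angular derivative of a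
-- periodic function, so `v` integrates to zero over each circle.
open MeasureTheory Set in
theorem integral_dbar_mul_inv {φ : ℂ → ℂ} (hφ : ContDiff ℝ 1 φ) (hc : HasCompactSupport φ) :
    ∫ w, dbar φ w * w⁻¹ = -(2 * Real.pi) * φ 0 := by
  let E : ℝ → ℂ := fun θ => Complex.exp (θ * Complex.I)
  have hE : Continuous E := by fun_prop
  have hEn : ∀ θ, ‖E θ‖ = 1 := fun θ => Complex.norm_exp_ofReal_mul_I θ
  let u : ℝ × ℝ → ℂ := fun p => fderiv ℝ φ (p.1 * E p.2) (E p.2)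
  let v : ℝ × ℝ → ℂ := fun p => fderiv ℝ φ (p.1 * E p.2) (Complex.I * E p.2)
  have hD := hφ.continuous_fderiv one_ne_zero
  have hu : Continuous u := by
    refine Continuous.clm_apply (hD.comp ?_) ?_ <;> fun_prop
  have hv : Continuous v := by
    refine Continuous.clm_apply (hD.comp ?_) ?_ <;> fun_prop
  obtain ⟨R, hR⟩ : ∃ R : ℝ, ∀ w, R < ‖w‖ → w ∉ tsupport φ := by
    obtain ⟨R, hR⟩ := hc.isBounded.exists_norm_le
    exact ⟨R, fun w hw h => absurd (hR w h) (not_le.2 hw)⟩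
  have hzero : ∀ (r θ : ℝ), R < |r| → fderiv ℝ φ (r * E θ) = 0 := by
    intro r θ hr
    by_contra h
    refine hR (r * E θ) (by simpa [hEn] using hr) (support_fderiv_subset ℝ (f := φ) h)
  have hint : ∀ g : ℝ × ℝ → ℂ, Continuous g → (∀ p : ℝ × ℝ, R < |p.1| → g p = 0) →
      IntegrableOn g (Ioi 0 ×ˢ Ioo (-Real.pi) Real.pi) := by
    intro g hg hg0
    have h1 : IntegrableOn g (Icc 0 R ×ˢ Icc (-Real.pi) Real.pi) :=
      hg.continuousOn.integrableOn_compact (isCompact_Icc.prod isCompact_Icc)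
    refine h1.of_forall_sdiff_eq_zero (measurableSet_Ioi.prod measurableSet_Ioo) ?_
    rintro ⟨r, θ⟩ ⟨⟨hr, hθ⟩, hn⟩
    refine hg0 _ (lt_of_not_ge fun h =>
      hn ⟨⟨le_of_lt hr, (le_abs_self r).trans h⟩, ⟨hθ.1.le, hθ.2.le⟩⟩)
  have hiu := hint u hu fun p hp => by simp [u, hzero p.1 p.2 hp]
  have hiv := hint v hv fun p hp => by simp [v, hzero p.1 p.2 hp]
  have e1 : ∫ w, dbar φ w * w⁻¹ =
      ∫ p in Ioi (0 : ℝ) ×ˢ Ioo (-Real.pi) Real.pi, (u p + Complex.I * v p) := by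
    rw [← Complex.integral_comp_polarCoord_symm]
    refine setIntegral_congr_fun (measurableSet_Ioi.prod measurableSet_Ioo) ?_
    rintro ⟨r, θ⟩ ⟨hr, -⟩
    have hr' : (r : ℂ) ≠ 0 := by exact_mod_cast (ne_of_gt hr)
    have hs : Complex.polarCoord.symm (r, θ) = r * E θ := by
      simp [E, Complex.exp_mul_I]
    have hEE : E θ * starRingEnd ℂ (E θ) = 1 := by
      rw [Complex.mul_conj, Complex.normSq_eq_norm_sq, hEn]; simp
    have hE0 : E θ ≠ 0 := Complex.exp_ne_zero _
    simp only [hs, u, v, dbar, apply_add_I_mul_apply_I_mul, eq_inv_of_mul_eq_one_right hEE,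
      Complex.real_smul]
    field_simp
  have hU : ∫ p in Ioi (0 : ℝ) ×ˢ Ioo (-Real.pi) Real.pi, u p = -(2 * Real.pi) * φ 0 := by
    have h0 : ∀ θ : ℝ, ∫ r in Ioi (0 : ℝ), u (r, θ) = - φ 0 := by
      intro θ
      let f : ℝ → ℂ := fun r => φ (r * E θ)
      have hf : ContDiff ℝ 1 f := hφ.comp ((Complex.ofRealCLM.contDiff).mul contDiff_const)
      have hfc : HasCompactSupport f := by
        refine HasCompactSupport.intro (isCompact_Icc (a := -R) (b := R)) fun r hr => ?_
        refine image_eq_zero_of_notMem_tsupport (f := φ) (hR (r * E θ) ?_)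
        simp only [norm_mul, hEn, Complex.norm_real, Real.norm_eq_abs, mul_one]
        by_contra! h
        exact hr (abs_le.1 h)
      have hd : ∀ r, deriv f r = u (r, θ) := by
        intro r
        have h1 : HasDerivAt (fun r : ℝ => (r : ℂ) * E θ) (E θ) r := by
          simpa using (Complex.ofRealCLM.hasDerivAt (x := r)).mul_const (E θ)
        exact ((hφ.differentiable one_ne_zero _).hasFDerivAt.comp_hasDerivAt r h1).deriv
      have := hfc.integral_Ioi_deriv_eq hf 0
      simpa [hd, f] using this
    rw [Measure.volume_eq_prod, setIntegral_prod _ hiu,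
      integral_integral_swap (f := fun r θ => u (r, θ))]
    · simp only [h0]
      rw [setIntegral_const, measureReal_def, Real.volume_Ioo,
        ENNReal.toReal_ofReal (by linarith [Real.pi_pos]), Complex.real_smul]
      push_cast
      ring
    · rw [Measure.prod_restrict]
      exact hiu
  have hV : ∫ p in Ioi (0 : ℝ) ×ˢ Ioo (-Real.pi) Real.pi, v p = 0 := by
    rw [Measure.volume_eq_prod, setIntegral_prod _ hiv]
    refine setIntegral_eq_zero_of_forall_eq_zero fun r hr => ?_
    have hr' : (r : ℂ) ≠ 0 := by exact_mod_cast (ne_of_gt hr)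
    have hd : ∀ θ : ℝ, HasDerivAt (fun θ : ℝ => φ (r * E θ)) (r * v (r, θ)) θ := by
      intro θ
      have h1 : HasDerivAt E (E θ * Complex.I) θ := by
        have := ((Complex.ofRealCLM.hasDerivAt (x := θ)).mul_const Complex.I).cexp
        simpa [E] using this
      have h2 := h1.const_mul (r : ℂ)
      have h3 := (hφ.differentiable one_ne_zero (r * E θ)).hasFDerivAt.comp_hasDerivAt θ h2
      have : (r : ℂ) * (E θ * Complex.I) = r • (Complex.I * E θ) := by
        rw [Complex.real_smul]; ring
      rw [this, map_smul, Complex.real_smul] at h3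
      exact h3
    have h4 := intervalIntegral.integral_eq_sub_of_hasDerivAt (a := -Real.pi) (b := Real.pi)
      (fun θ _ => hd θ) (Continuous.intervalIntegrable (by fun_prop) _ _)
    have h5 : E Real.pi = E (-Real.pi) := by
      simp [E, Complex.exp_neg]
    rw [h5, sub_self, intervalIntegral.integral_const_mul] at h4
    rw [← integral_Ioc_eq_integral_Ioo,
      ← intervalIntegral.integral_of_le (by linarith [Real.pi_pos])]
    exact (mul_eq_zero.1 h4).resolve_left hr'
  rw [e1, integral_add hiu (hiv.const_mul _), hU, integral_const_mul, hV]
  simp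

open MeasureTheory in
/-- The Cauchy–Pompeiu formula for compactly supported functions. -/
theorem integral_dbar_mul_inv_sub {φ : ℂ → ℂ} (hφ : ContDiff ℝ 1 φ) (hc : HasCompactSupport φ)
    (z : ℂ) : ∫ w, dbar φ w * (w - z)⁻¹ = -(2 * Real.pi) * φ z := by
  have h := integral_dbar_mul_inv (φ := fun w => φ (w + z))
    (hφ.comp (contDiff_id.add contDiff_const))
    (hc.comp_homeomorph (Homeomorph.addRight z))
  have hd : ∀ w, dbar (fun w => φ (w + z)) w = dbar φ (w + z) := fun w => by
    simp only [dbar, fderiv_comp_add_right]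
  simp only [hd, zero_add] at h
  rw [← h, ← integral_add_right_eq_self _ z]
  simp

/-! ### Logarithms and the complement of `Ω` -/

theorem exists_hasDerivAt_inv_sub {Ω : Set ℂ} (hΩ : IsOpen Ω)
    (hsc : ∀ z ∈ Ω, IsSimplyConnected (connectedComponentIn Ω z)) {a : ℂ} (ha : a ∉ Ω) :
    ∃ L : ℂ → ℂ, ∀ z ∈ Ω, HasDerivAt L (z - a)⁻¹ z := by
  -- The hypotheses stand inside the existential so that `choose` makes the branch of the logarithm
  -- depend on the set `C` alone; points of one component then share one branch.
  have key : ∀ C : Set ℂ, ∃ f : ℂ → ℂ, IsSimplyConnected C → IsOpen C → a ∉ C →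
      ∀ z ∈ C, HasDerivAt f (z - a)⁻¹ z := by
    intro C
    by_cases hC : IsSimplyConnected C ∧ IsOpen C ∧ a ∉ C
    swap
    · exact ⟨0, fun h1 h2 h3 => absurd ⟨h1, h2, h3⟩ hC⟩
    obtain ⟨h1, h2, h3⟩ := hC
    obtain ⟨f, hf, hfe⟩ := Complex.exists_continuousOn_eqOn_exp_comp h1 h2 (g := fun z => z - a)
      (by fun_prop) (by
        rintro ⟨z, hz, hza⟩
        exact h3 (sub_eq_zero.1 hza ▸ hz))
    refine ⟨f, fun _ _ _ z hz => ?_⟩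
    have hfz : Complex.exp (f z) = z - a := hfe hz
    have hd : HasDerivAt (fun w => Complex.exp w + a) (z - a) (f z) := by
      simpa [hfz] using (Complex.hasDerivAt_exp (f z)).add_const a
    refine HasDerivAt.of_local_left_inverse (hf.continuousAt (h2.mem_nhds hz)) hd ?_ ?_
    · rw [← hfz]; exact Complex.exp_ne_zero _
    · filter_upwards [h2.mem_nhds hz] with y hy
      have : Complex.exp (f y) = y - a := hfe hy
      simp [this]
  choose f hf using key
  refine ⟨fun z => f (connectedComponentIn Ω z) z, fun z hz => ?_⟩
  have hm := mem_connectedComponentIn hz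
  have ho : IsOpen (connectedComponentIn Ω z) := hΩ.connectedComponentIn
  have haC : a ∉ connectedComponentIn Ω z := fun h => ha (connectedComponentIn_subset _ _ h)
  refine (hf _ (hsc z hz) ho haC z hm).congr_of_eventuallyEq ?_
  filter_upwards [ho.mem_nhds hm] with y hy
  rw [connectedComponentIn_eq hy]

open MeasureTheory in
theorem integral_mul_fderiv_eq_neg {Ω : Set ℂ} (hΩ : IsOpen Ω) {L l g : ℂ → ℂ}
    (hL : ∀ z ∈ Ω, HasDerivAt L (l z) z) (hl : ContinuousOn l Ω) (hg : ContDiff ℝ 1 g)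
    (hc : HasCompactSupport g) (hs : tsupport g ⊆ Ω) (v : ℂ) :
    ∫ z, L z * fderiv ℝ g z v = -∫ z, l z * v * g z := by
  have hD : Continuous fun z => fderiv ℝ g z v :=
    (hg.continuous_fderiv one_ne_zero).clm_apply continuous_const
  have hts : tsupport (fun z => fderiv ℝ g z v) ⊆ tsupport g := by
    refine closure_minimal (fun z hz => ?_) (isClosed_tsupport g)
    by_contra h
    exact hz (by simp [(notMem_tsupport_iff_eventuallyEq.1 h).fderiv_eq])
  have hDc : HasCompactSupport fun z => fderiv ℝ g z v :=
    hc.of_isClosed_subset (isClosed_tsupport _) hts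
  have hLc : ContinuousOn L Ω := fun z hz => (hL z hz).continuousAt.continuousWithinAt
  -- Off `Ω` the factor `h` is arbitrary, but there the product vanishes locally.
  have hcont : ∀ (h k : ℂ → ℂ), ContinuousOn h Ω → Continuous k → HasCompactSupport k →
      tsupport k ⊆ Ω → Integrable fun z => h z * k z := by
    intro h k hh hk hkc hks
    refine Continuous.integrable_of_hasCompactSupport ?_ hkc.mul_left
    rw [continuous_iff_continuousAt]
    intro z
    by_cases hz : z ∈ tsupport k
    · exact (hh.continuousAt (hΩ.mem_nhds (hks hz))).mul hk.continuousAt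
    · refine ContinuousAt.congr (f := fun _ => 0) continuousAt_const ?_
      filter_upwards [notMem_tsupport_iff_eventuallyEq.1 hz] with y hy
      simp [hy]
  have := integral_bilinear_hasLineDerivAt_right_eq_neg_left_of_integrable (μ := volume)
    (f := L) (f' := fun z => l z * v) (g := g) (g' := fun z => fderiv ℝ g z v) (v := v)
    (B := ContinuousLinearMap.mul ℝ ℂ)
    (hcont _ _ (hl.mul continuousOn_const) hg.continuous hc hs)
    (hcont _ _ hLc hD hDc (hts.trans hs)) (hcont _ _ hLc hg.continuous hc hs)
    (fun z hz => by
      have := ((hL z (hs hz)).hasFDerivAt.restrictScalars ℝ).hasLineDerivAt v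
      simpa [mul_comm] using this)
    (fun z _ => ((hg.differentiable one_ne_zero z).hasFDerivAt.hasLineDerivAt v))
  simpa using this

/-- Being `1` near `A`, not only on it, makes the derivatives vanish near `A`. Order 2 allows mixed
second derivatives. -/
theorem exists_contDiff_eq_one_nhds {A U : Set ℂ} (hA : IsCompact A) (hU : IsOpen U) (hAU : A ⊆ U) :
    ∃ φ : ℂ → ℂ, ContDiff ℝ 2 φ ∧ HasCompactSupport φ ∧ tsupport φ ⊆ U ∧ ∀ z ∈ A, φ =ᶠ[𝓝 z] 1 := by
  obtain ⟨t, ht, hAt, htU⟩ := exists_compact_between hA hU hAU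
  obtain ⟨f, h1, h0, -⟩ := exists_contMDiffMap_one_nhds_of_subset_interior (n := 2)
    (modelWithCornersSelf ℝ ℂ) hA.isClosed hAt
  have hsub : tsupport (fun z => (f z : ℂ)) ⊆ t := by
    refine closure_minimal (fun z hz => ?_) ht.isClosed
    by_contra h
    exact hz (by simp [h0 z h])
  refine ⟨fun z => (f z : ℂ), Complex.ofRealCLM.contDiff.comp f.contMDiff.contDiff,
    ht.of_isClosed_subset (isClosed_tsupport _) hsub, hsub.trans htU, fun z hz => ?_⟩
  filter_upwards [h1.filter_mono (nhds_le_nhdsSet hz)] with y hy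
  simp [hy]

open MeasureTheory in
/-- The complement of an open set with simply connected components has no nonempty compact part
that is separated from the rest. -/
theorem eq_empty_of_isCompact_of_disjoint {Ω A B : Set ℂ} (hΩ : IsOpen Ω)
    (hsc : ∀ z ∈ Ω, IsSimplyConnected (connectedComponentIn Ω z)) (hA : IsCompact A)
    (hB : IsClosed B) (hd : Disjoint A B) (hAB : A ∪ B = Ωᶜ) : A = ∅ := by
  by_contra hne
  obtain ⟨a, ha⟩ := Set.nonempty_iff_ne_empty.2 hne
  have haΩ : a ∉ Ω := by
    have : a ∈ Ωᶜ := hAB ▸ Or.inl ha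
    exact this
  obtain ⟨L, hL⟩ := exists_hasDerivAt_inv_sub hΩ hsc haΩ
  obtain ⟨φ, hφ, hc, hsB, h1⟩ := exists_contDiff_eq_one_nhds hA hB.isOpen_compl
    (Set.subset_compl_iff_disjoint_right.2 hd)
  have hl : ContinuousOn (fun z : ℂ => (z - a)⁻¹) Ω :=
    ContinuousOn.inv₀ (by fun_prop) fun z hz h => haΩ (sub_eq_zero.1 h ▸ hz)
  -- The derivative of `φ` lives in `Ω`, where the logarithm `L` is available.
  have hdz : ∀ z ∉ Ω, fderiv ℝ φ =ᶠ[𝓝 z] 0 := by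
    intro z hz
    have hz' : z ∈ A ∪ B := hAB ▸ hz
    rcases hz' with hz' | hz'
    · filter_upwards [(h1 z hz').eventually_nhds] with y hy
      rw [Filter.EventuallyEq.fderiv_eq hy]
      simp
    · have : z ∉ tsupport φ := fun h => hsB h hz'
      filter_upwards [(notMem_tsupport_iff_eventuallyEq.1 this).eventually_nhds] with y hy
      rw [Filter.EventuallyEq.fderiv_eq hy]
      simp
  have hsup : ∀ v : ℂ, tsupport (fun z => fderiv ℝ φ z v) ⊆ Ω := by
    intro v z hz
    by_contra hzΩ
    refine notMem_tsupport_iff_eventuallyEq.2 ?_ hz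
    filter_upwards [hdz z hzΩ] with y hy
    simp [hy]
  have hg : ∀ v : ℂ, ContDiff ℝ 1 fun z => fderiv ℝ φ z v := fun v =>
    (hφ.fderiv_right (m := 1) (by norm_num)).clm_apply contDiff_const
  have hgc : ∀ v : ℂ, HasCompactSupport fun z => fderiv ℝ φ z v := fun v =>
    (hc.fderiv ℝ).comp_left (g := fun D : ℂ →L[ℝ] ℂ => D v) rfl
  -- Integrating `L` against the mixed second derivative of `φ` in both orders gives `∫ φ_y / (z -
  -- a) = I * ∫ φ_x / (z - a)`. Hence `∫ dbar φ / (z - a) = 0`, whereas Cauchy–Pompeiu gives `-2π *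
  -- φ a = -2π`.
  have i1 := integral_mul_fderiv_eq_neg hΩ hL hl (hg Complex.I) (hgc _) (hsup _) 1
  have i2 := integral_mul_fderiv_eq_neg hΩ hL hl (hg 1) (hgc _) (hsup _) Complex.I
  have hsymm : ∀ z, fderiv ℝ (fun z => fderiv ℝ φ z Complex.I) z 1 =
      fderiv ℝ (fun z => fderiv ℝ φ z 1) z Complex.I := by
    intro z
    have hdd : DifferentiableAt ℝ (fderiv ℝ φ) z :=
      (hφ.fderiv_right (m := 1) (by norm_num)).differentiable one_ne_zero z
    have hs := (hφ.contDiffAt (x := z)).isSymmSndFDerivAt (by simp)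
    have h' : ∀ v w : ℂ, fderiv ℝ (fun z => fderiv ℝ φ z v) z w = fderiv ℝ (fderiv ℝ φ) z w v := by
      intro v w
      rw [fderiv_clm_apply hdd (differentiableAt_const v)]
      simp
    rw [h', h']
    exact hs 1 Complex.I
  simp only [hsymm] at i1
  rw [i1, neg_inj] at i2
  have hint : ∀ v : ℂ, Integrable fun z => (z - a)⁻¹ * fderiv ℝ φ z v := by
    intro v
    refine Continuous.integrable_of_hasCompactSupport ?_ (hgc v).mul_left
    rw [continuous_iff_continuousAt]
    intro z
    by_cases hz : z ∈ Ω
    · exact (hl.continuousAt (hΩ.mem_nhds hz)).mul (hg v).continuous.continuousAt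
    · refine ContinuousAt.congr (f := fun _ => 0) continuousAt_const ?_
      filter_upwards [hdz z hz] with y hy
      simp [hy]
  have hp := integral_dbar_mul_inv_sub (hφ.of_le (by norm_num)) hc a
  have hp2 : ∫ w, dbar φ w * (w - a)⁻¹ = 0 := by
    have e : ∀ w, dbar φ w * (w - a)⁻¹ = (w - a)⁻¹ * fderiv ℝ φ w 1 +
        Complex.I * ((w - a)⁻¹ * fderiv ℝ φ w Complex.I) := fun w => by
      simp only [dbar]; ring
    simp only [e]
    rw [integral_add (hint _) ((hint _).const_mul _), integral_const_mul]
    have e2 : ∫ z, (z - a)⁻¹ * Complex.I * fderiv ℝ φ z 1 =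
        Complex.I * ∫ z, (z - a)⁻¹ * fderiv ℝ φ z 1 := by
      rw [← integral_const_mul]
      congr 1
      ext z
      ring
    rw [e2] at i2
    simp only [mul_one] at i2
    rw [i2]
    linear_combination (∫ z, (z - a)⁻¹ * fderiv ℝ φ z 1) * Complex.I_mul_I
  rw [hp2, (h1 a ha).self_of_nhds] at hp
  simp at hp

/-! ### Runge's theorem -/

open MeasureTheory in
/-- **Runge's theorem**: on an open set with simply connected components, holomorphic functions are
locally uniform limits of polynomials. -/
theorem exists_polynomial_near_of_isSimplyConnected {Ω : Set ℂ} (hΩ : IsOpen Ω)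
    (hsc : ∀ z ∈ Ω, IsSimplyConnected (connectedComponentIn Ω z)) {K : Set ℂ} (hK : IsCompact K)
    (hKΩ : K ⊆ Ω) {f : ℂ → ℂ} (hf : DifferentiableOn ℂ f Ω) {ε : ℝ} (hε : 0 < ε) :
    ∃ P : ℂ[X], ∀ z ∈ K, ‖P.eval z - f z‖ < ε := by
  have : CompactSpace K := isCompact_iff_compactSpace.1 hK
  let V : Subalgebra ℂ C(K, ℂ) := (polynomialFunctions K).topologicalClosure
  have hV : IsClosed (V : Set C(K, ℂ)) := Subalgebra.isClosed_topologicalClosure _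
  have : CompleteSpace V := hV.completeSpace_coe
  have hpoly : ∀ P : ℂ[X], P.toContinuousMapOn K ∈ V := fun P =>
    Subalgebra.le_topologicalClosure _ ⟨P, Algebra.mem_top, rfl⟩
  let x : V := ⟨X.toContinuousMapOn K, hpoly X⟩
  have hx : ∀ z : K, (x : C(K, ℂ)) z = z := fun z => by simp [x]
  let S := spectrum ℂ x
  have hScomp : IsCompact S := spectrum.isCompact x
  have hspecK : spectrum ℂ (x : C(K, ℂ)) = K := by
    rw [ContinuousMap.spectrum_eq_range]
    ext w
    simp [hx]
  have hKS : K ⊆ S := hspecK ▸ spectrum.subset_subalgebra x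
  have hopen : IsOpen (S \ K) := by
    -- Passing to a closed subalgebra creates no new boundary points of the spectrum.
    have hfr : frontier S ⊆ K := by
      have := Subalgebra.frontier_spectrum V x
      rwa [hspecK] at this
    have : S \ K = interior S \ K := by
      refine Set.Subset.antisymm (fun w hw => ⟨?_, hw.2⟩) (Set.sdiff_subset_sdiff_left interior_subset)
      by_contra h
      exact hw.2 (hfr ⟨subset_closure hw.1, h⟩)
    rw [this]
    exact isOpen_interior.sdiff hK.isClosed
  have hSΩ : S ⊆ Ω := by
    rw [← Set.sdiff_eq_empty]
    -- Since `K ⊆ Ω`, `S \ Ω` is the trace on `Ωᶜ` of the open set `S \ K`, so the rest of `Ωᶜ` is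
    -- closed.
    refine eq_empty_of_isCompact_of_disjoint hΩ hsc (hScomp.diff hΩ) (B := Ωᶜ \ (S \ K))
      (hΩ.isClosed_compl.sdiff hopen) ?_ ?_
    · rw [Set.disjoint_left]
      exact fun w hw hw' => hw'.2 ⟨hw.1, fun h => hw.2 (hKΩ h)⟩
    · ext w
      have := @hKΩ w
      simp only [Set.mem_union, Set.mem_sdiff, Set.mem_compl_iff]
      tauto
  obtain ⟨χ, hχ, hχc, hχΩ, hχ1⟩ := exists_contDiff_eq_one_nhds hScomp hΩ hSΩ
  let g : ℂ → ℂ := fun z => f z * χ z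
  have hgc : HasCompactSupport g := hχc.mul_left
  have hg : ContDiff ℝ 1 g := by
    rw [contDiff_iff_contDiffAt]
    intro z
    by_cases hz : z ∈ tsupport χ
    · have h1 : ContDiffAt ℂ 1 f z := (hf.analyticAt (hΩ.mem_nhds (hχΩ hz))).contDiffAt
      exact (h1.restrict_scalars ℝ).mul (hχ.contDiffAt.of_le (by norm_num))
    · refine ContDiffAt.congr_of_eventuallyEq (f := fun _ => 0) contDiffAt_const ?_
      filter_upwards [notMem_tsupport_iff_eventuallyEq.1 hz] with y hy
      simp [g, hy]
  have hgS : ∀ z ∈ S, dbar g =ᶠ[𝓝 z] 0 := by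
    intro z hz
    filter_upwards [(hχ1 z hz).eventually_nhds, hΩ.mem_nhds (hSΩ hz)] with y hy hyΩ
    have : g =ᶠ[𝓝 y] f := by
      filter_upwards [hy] with w hw
      simp [g, hw]
    rw [dbar_congr this]
    exact dbar_eq_zero_of_differentiableAt (hf.differentiableAt (hΩ.mem_nhds hyΩ))
  -- The resolvent is singular only on `S`, and `dbar g` vanishes near `S`.
  let G : ℂ → V := fun w => dbar g w • resolvent x w
  have hGcont : Continuous G := by
    rw [continuous_iff_continuousAt]
    intro w
    by_cases hw : w ∈ S
    · refine ContinuousAt.congr (f := fun _ => 0) continuousAt_const ?_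
      filter_upwards [hgS w hw] with y hy
      simp [G, hy]
    · exact (continuous_dbar hg).continuousAt.smul
        (spectrum.hasDerivAt_resolvent_const_left (by simpa [spectrum, S] using hw)).continuousAt
  have hdc : HasCompactSupport (dbar g) :=
    hgc.of_isClosed_subset (isClosed_tsupport _) (tsupport_dbar_subset g)
  have hGint : Integrable G := hGcont.integrable_of_hasCompactSupport hdc.smul_right
  let T : V := ∫ w, G w
  -- Evaluation at `z` is a character of `V` and sends the resolvent to `(w - z)⁻¹`, so
  -- Cauchy–Pompeiu applies under the integral.
  have hT : ∀ z : K, (T : C(K, ℂ)) z = -(2 * Real.pi) * f z := by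
    intro z
    let ev : V →L[ℂ] ℂ := (ContinuousMap.evalCLM ℂ z).comp V.toSubmodule.subtypeL
    have h1 : ev T = ∫ w, ev (G w) := (ev.integral_comp_comm hGint).symm
    have h2 : ∀ w, ev (G w) = dbar g w * (w - z)⁻¹ := by
      intro w
      by_cases hw : w ∈ S
      · have : dbar g w = 0 := (hgS w hw).self_of_nhds
        simp [G, this]
      · have hu : IsUnit (algebraMap ℂ V w - x) := by
          simpa [S] using spectrum.notMem_iff.1 hw
        have h3 : (algebraMap ℂ V w - x) * resolvent x w = 1 := Ring.mul_inverse_cancel _ hu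
        have h4 : (w - (z : ℂ)) * ((resolvent x w : V) : C(K, ℂ)) z = 1 := by
          have := congrArg (fun y : V => (y : C(K, ℂ)) z) h3
          simpa [hx] using this
        have h5 : ((resolvent x w : V) : C(K, ℂ)) z = (w - z)⁻¹ := eq_inv_of_mul_eq_one_right h4
        change (dbar g w • ((resolvent x w : V) : C(K, ℂ))) z = _
        rw [ContinuousMap.smul_apply, h5, smul_eq_mul]
    have h3 : g z = f z := by
      simp [g, (hχ1 z (hKS z.2)).self_of_nhds]
    change ev T = _
    rw [h1]
    simp only [h2]
    rw [integral_dbar_mul_inv_sub hg hgc, h3]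
  let T' : V := (-(2 * Real.pi : ℂ))⁻¹ • T
  have hT' : ∀ z : K, (T' : C(K, ℂ)) z = f z := by
    intro z
    have hpi : (Real.pi : ℂ) ≠ 0 := by exact_mod_cast Real.pi_ne_zero
    change (-(2 * Real.pi : ℂ))⁻¹ * (T : C(K, ℂ)) z = f z
    rw [hT]
    field_simp
  have hmem : (T' : C(K, ℂ)) ∈ closure (polynomialFunctions K : Set C(K, ℂ)) := by
    rw [← Subalgebra.topologicalClosure_coe]
    exact T'.2
  obtain ⟨_, ⟨P, -, rfl⟩, hP⟩ := Metric.mem_closure_iff.1 hmem ε hε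
  refine ⟨P, fun z hz => ?_⟩
  have := (ContinuousMap.dist_lt_iff hε).1 hP ⟨z, hz⟩
  rw [hT', dist_comm, dist_eq_norm] at this
  simpa using this

/-! ### Continuity of Padé approximants and the `Gδ` property -/

namespace Pade

theorem zeroExt_of_mem {Ω : Set ℂ} (f : C(Ω, ℂ)) {z : ℂ} (hz : z ∈ Ω) :
    zeroExt f z = f ⟨z, hz⟩ := by
  simp [zeroExt, hz]

/-- By Weierstrass, locally uniform convergence of holomorphic functions passes to derivatives. -/
theorem continuous_taylorCoeff {Ω : Set ℂ} (hΩ : IsOpen Ω) {ζ : ℂ} (hζ : ζ ∈ Ω) (v : ℕ) :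
    Continuous fun f : H Ω => taylorCoeff f ζ v := by
  have := hΩ.locallyCompactSpace
  suffices h : Continuous fun f : H Ω => iteratedDeriv v (zeroExt f.1) ζ by
    unfold taylorCoeff
    fun_prop
  rw [continuous_iff_continuousAt]
  intro f₀
  have hiter : ∀ v : ℕ, TendstoLocallyUniformlyOn
        (fun f : H Ω => iteratedDeriv v (zeroExt f.1)) (iteratedDeriv v (zeroExt f₀.1)) (𝓝 f₀) Ω ∧
      ∀ f : H Ω, DifferentiableOn ℂ (iteratedDeriv v (zeroExt f.1)) Ω := by
    intro v
    induction v with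
    | zero =>
      simp only [iteratedDeriv_zero]
      refine ⟨?_, fun f => f.2⟩
      rw [tendstoLocallyUniformlyOn_iff_tendstoLocallyUniformly_comp_coe]
      have h1 : Tendsto (fun f : H Ω => f.1) (𝓝 f₀) (𝓝 f₀.1) :=
        continuous_subtype_val.continuousAt
      rw [ContinuousMap.tendsto_iff_tendstoLocallyUniformly] at h1
      convert h1 using 1
      · funext f z
        exact zeroExt_of_mem f.1 z.2
      · funext z
        exact zeroExt_of_mem f₀.1 z.2
    | succ v ih =>
      simp only [iteratedDeriv_succ]
      exact ⟨ih.1.deriv (Eventually.of_forall ih.2) hΩ, fun f => (ih.2 f).deriv hΩ⟩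
  exact (hiter v).1.tendsto_at hζ

theorem continuous_hankel {Ω : Set ℂ} (hΩ : IsOpen Ω) {ζ : ℂ} (hζ : ζ ∈ Ω) (p q : ℕ) :
    Continuous fun f : H Ω => hankel (taylorCoeff f ζ) p q := by
  refine continuous_matrix fun i j => ?_
  simp only [hankel, Matrix.of_apply]
  split_ifs
  · exact continuous_taylorCoeff hΩ hζ _
  · exact continuous_const

theorem isOpen_D {Ω : Set ℂ} (hΩ : IsOpen Ω) {ζ : ℂ} (hζ : ζ ∈ Ω) (p q : ℕ) :
    IsOpen (D p q ζ : Set (H Ω)) :=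
  isOpen_ne_fun (continuous_hankel hΩ hζ p q).matrix_det continuous_const

/-- The coefficients of order `p + 1, …, p + q` give a Hankel system; solving it shows the
denominator to be continuous in `f`. -/
theorem IsPade.den_coeff_eq {a : ℕ → ℂ} {p q : ℕ} {N Q : ℂ[X]} (hdet : (hankel a p q).det ≠ 0)
    (h : IsPade a p q N Q) (j : Fin q) :
    Q.coeff (q - j) = ((hankel a p q)⁻¹.mulVec fun i : Fin q => -a (p + 1 + i)) j := by
  have key : (hankel a p q).mulVec (fun j : Fin q => Q.coeff (q - j)) =
      fun i : Fin q => -a (p + 1 + i) := by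
    funext i
    have h1 := (isPade_taylor_iff a (p + q) N Q h.den_zero).1 h.taylor (p + 1 + i) (by omega)
    rw [coeff_den_mul a p q Q h.natDegree_den i, h.den_zero, one_mul,
      Polynomial.coeff_eq_zero_of_natDegree_lt
        (lt_of_le_of_lt h.natDegree_num (by omega))] at h1
    linear_combination h1
  rw [← key, Matrix.mulVec_mulVec, Matrix.nonsing_inv_mul _ (isUnit_iff_ne_zero.2 hdet),
    Matrix.one_mulVec]

theorem IsPade.num_coeff_eq {a : ℕ → ℂ} {p q : ℕ} {N Q : ℂ[X]} (h : IsPade a p q N Q) {l : ℕ}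
    (hl : l ≤ p) :
    N.coeff l = ∑ i ∈ Finset.HasAntidiagonal.antidiagonal l, Q.coeff i.1 * a i.2 := by
  rw [← (isPade_taylor_iff a (p + q) N Q h.den_zero).1 h.taylor l (by omega),
    PowerSeries.coeff_mul]
  simp

theorem continuousOn_den_coeff {Ω : Set ℂ} (hΩ : IsOpen Ω) {ζ : ℂ} (hζ : ζ ∈ Ω) (p q l : ℕ) :
    ContinuousOn (fun f : H Ω => (padePair f ζ p q).2.coeff l) (D p q ζ) := by
  rcases Nat.eq_zero_or_pos l with rfl | hl
  · exact continuousOn_const.congr fun f hf => (padePair_isPade hf).den_zero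
  by_cases hlq : l ≤ q
  · have h1 : ContinuousOn (fun f : H Ω => ((hankel (taylorCoeff f ζ) p q)⁻¹.mulVec
        fun i : Fin q => -taylorCoeff f ζ (p + 1 + i)) ⟨q - l, by omega⟩) (D p q ζ) := by
      have hdet : ContinuousOn (fun f : H Ω => (hankel (taylorCoeff f ζ) p q).det⁻¹) (D p q ζ) :=
        (continuous_hankel hΩ hζ p q).matrix_det.continuousOn.inv₀ fun f hf => hf
      have hadj := (continuous_hankel hΩ hζ p q).matrix_adjugate
      have hvec : ∀ i : Fin q, Continuous fun f : H Ω => -taylorCoeff f ζ (p + 1 + i) :=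
        fun i => (continuous_taylorCoeff hΩ hζ _).neg
      simp only [Matrix.inv_def, Ring.inverse_eq_inv', Matrix.mulVec, dotProduct, Matrix.smul_apply,
        smul_eq_mul]
      refine continuousOn_finsetSum _ fun i _ => ?_
      exact (hdet.mul (hadj.matrix_elem _ i).continuousOn).mul (hvec i).continuousOn
    refine h1.congr fun f hf => ?_
    have := (padePair_isPade hf).den_coeff_eq hf ⟨q - l, by omega⟩
    rwa [Nat.sub_sub_self hlq] at this
  · exact (continuousOn_const (c := (0 : ℂ))).congr fun f hf =>
      Polynomial.coeff_eq_zero_of_natDegree_lt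
        (lt_of_le_of_lt (padePair_isPade hf).natDegree_den (by omega))

theorem continuousOn_num_coeff {Ω : Set ℂ} (hΩ : IsOpen Ω) {ζ : ℂ} (hζ : ζ ∈ Ω) (p q l : ℕ) :
    ContinuousOn (fun f : H Ω => (padePair f ζ p q).1.coeff l) (D p q ζ) := by
  by_cases hl : l ≤ p
  · refine ContinuousOn.congr (continuousOn_finsetSum (Finset.HasAntidiagonal.antidiagonal l) fun i _ =>
      (continuousOn_den_coeff hΩ hζ p q i.1).mul (continuous_taylorCoeff hΩ hζ i.2).continuousOn)
      fun f hf => (padePair_isPade hf).num_coeff_eq hl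
  · exact (continuousOn_const (c := (0 : ℂ))).congr fun f hf =>
      Polynomial.coeff_eq_zero_of_natDegree_lt
        (lt_of_le_of_lt (padePair_isPade hf).natDegree_num (by omega))

theorem continuousOn_eval_sub {T : Type*} [TopologicalSpace T] {P : T → ℂ[X]} {s : Set T} {m : ℕ}
    (hdeg : ∀ t ∈ s, (P t).natDegree ≤ m) (hP : ∀ l, ContinuousOn (fun t => (P t).coeff l) s)
    (Ω : Set ℂ) (ζ : ℂ) :
    ContinuousOn (fun x : T × Ω => (P x.1).eval ((x.2 : ℂ) - ζ)) (s ×ˢ Set.univ) := by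
  refine ContinuousOn.congr (continuousOn_finsetSum (Finset.range (m + 1)) fun l _ =>
    ((hP l).comp continuousOn_fst fun x hx => hx.1).mul
      (f := fun x : T × Ω => (P x.1).coeff l) (g := fun x => ((x.2 : ℂ) - ζ) ^ l) (by fun_prop))
    fun x hx => ?_
  exact Polynomial.eval_eq_sum_range' (Nat.lt_succ_of_le (hdeg _ hx.1)) _

/-- The value at `z` is jointly continuous in `(f, z)` away from poles, and compactness of `K` makes
the open conditions uniform in `z`. -/
theorem isOpen_setOf_pade_near {Ω : Set ℂ} (hΩ : IsOpen Ω) {ζ : ℂ} (hζ : ζ ∈ Ω) (p q : ℕ)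
    {K : Set Ω} (hK : IsCompact K) (ε : ℝ) :
    IsOpen {f : H Ω | f ∈ D p q ζ ∧
      ∀ z ∈ K, padeDen f ζ p q z ≠ 0 ∧ ‖pade f ζ p q z - f.1 z‖ < ε} := by
  have := hΩ.locallyCompactSpace
  rw [isOpen_iff_mem_nhds]
  rintro f₀ ⟨hf₀, h₀⟩
  have hD := isOpen_D hΩ hζ p q
  have hU : IsOpen ((D p q ζ : Set (H Ω)) ×ˢ (Set.univ : Set Ω)) := hD.prod isOpen_univ
  refine inter_mem (hD.mem_nhds hf₀) ?_
  refine hK.eventually_forall_of_forall_eventually (P := fun (f : H Ω) (z : Ω) =>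
    padeDen f ζ p q z ≠ 0 ∧ ‖pade f ζ p q z - f.1 z‖ < ε) fun z hz => ?_
  have hden : ContinuousAt (fun x : H Ω × Ω => padeDen x.1 ζ p q x.2) (f₀, z) :=
    (continuousOn_eval_sub (P := fun f : H Ω => (padePair f ζ p q).2)
      (fun f hf => (padePair_isPade hf).natDegree_den)
      (continuousOn_den_coeff hΩ hζ p q) Ω ζ).continuousAt (hU.mem_nhds ⟨hf₀, trivial⟩)
  have hnum : ContinuousAt (fun x : H Ω × Ω => (padePair x.1 ζ p q).1.eval ((x.2 : ℂ) - ζ)) (f₀, z) :=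
    (continuousOn_eval_sub (P := fun f : H Ω => (padePair f ζ p q).1)
      (fun f hf => (padePair_isPade hf).natDegree_num)
      (continuousOn_num_coeff hΩ hζ p q) Ω ζ).continuousAt (hU.mem_nhds ⟨hf₀, trivial⟩)
  have hev : Continuous fun x : H Ω × Ω => x.1.1 x.2 := by fun_prop
  have hpade : ContinuousAt (fun x : H Ω × Ω => ‖pade x.1 ζ p q x.2 - x.1.1 x.2‖) (f₀, z) :=
    ((hnum.div hden (h₀ z hz).1).sub hev.continuousAt).norm
  exact (hden.eventually_ne (h₀ z hz).1).and (hpade.eventually_lt_const (h₀ z hz).2)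

theorem padeLimits_eq_iInter {Ω : Set ℂ} (F : Set (ℕ × ℕ)) (ζ : ℂ) (E : CompactExhaustion Ω) :
    padeLimits Ω F ζ = ⋂ m : ℕ, ⋃ r ∈ F, {f : H Ω | f ∈ D r.1 r.2 ζ ∧
      ∀ z ∈ E m, padeDen f ζ r.1 r.2 z ≠ 0 ∧
        ‖pade f ζ r.1 r.2 z - f.1 z‖ < 1 / ((m : ℝ) + 1)} := by
  ext f
  simp only [Set.mem_iInter, Set.mem_iUnion, Set.mem_ofPred_eq, exists_prop]
  constructor
  · rintro ⟨p, q, hF, hD, hK⟩ m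
    obtain ⟨h1, h2⟩ := hK ((↑) '' (E m)) (by rintro _ ⟨z, -, rfl⟩; exact z.2)
      ((E.isCompact m).image continuous_subtype_val)
    obtain ⟨n, hn1, hn2⟩ := (h1.and (Metric.tendstoUniformlyOn_iff.1 h2 (1 / ((m : ℝ) + 1))
      Nat.one_div_pos_of_nat)).exists
    refine ⟨(p n, q n), hF n, hD n, fun z hz => ⟨hn1 z ⟨z, hz, rfl⟩, ?_⟩⟩
    have := hn2 z ⟨z, hz, rfl⟩
    rwa [dist_comm, dist_eq_norm, zeroExt_of_mem f.1 z.2] at this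
  · intro h
    -- The pairs chosen at successive levels already form the required sequence, since each compact
    -- set lies in all late `E n`.
    choose r hr hD hE using h
    refine ⟨fun n => (r n).1, fun n => (r n).2, hr, hD, fun K hKΩ hK => ?_⟩
    have hK' : IsCompact ((↑) ⁻¹' K : Set Ω) := by
      rw [Subtype.isCompact_iff, Subtype.image_preimage_coe, Set.inter_eq_right.2 hKΩ]
      exact hK
    obtain ⟨m, hm⟩ := E.exists_superset_of_isCompact hK'
    have hsub : ∀ n ≥ m, ∀ z (hz : z ∈ K), (⟨z, hKΩ hz⟩ : Ω) ∈ E n := fun n hn z hz =>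
      E.subset hn (hm hz)
    constructor
    · filter_upwards [eventually_ge_atTop m] with n hn z hz
      exact (hE n _ (hsub n hn z hz)).1
    · rw [Metric.tendstoUniformlyOn_iff]
      intro ε hε
      filter_upwards [eventually_ge_atTop m,
        (tendsto_one_div_add_atTop_nhds_zero_nat (𝕜 := ℝ)).eventually_lt_const hε] with n hn hnε z hz
      rw [dist_comm, dist_eq_norm, zeroExt_of_mem f.1 (hKΩ hz)]
      exact (hE n _ (hsub n hn z hz)).2.trans hnε

theorem isGδ_padeLimits {Ω : Set ℂ} (hΩ : IsOpen Ω) (F : Set (ℕ × ℕ)) {ζ : ℂ} (hζ : ζ ∈ Ω) :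
    IsGδ (padeLimits Ω F ζ) := by
  have := hΩ.locallyCompactSpace
  rw [padeLimits_eq_iInter F ζ (CompactExhaustion.choice Ω)]
  exact IsGδ.iInter_of_isOpen fun m => isOpen_biUnion fun r _ =>
    isOpen_setOf_pade_near hΩ hζ r.1 r.2 (CompactExhaustion.isCompact _ m) _

/-! ### Polynomials as Padé limits, and density -/

/-- Reversing the columns turns the entries into `a_{p+i-j}`: an upper triangular matrix with `a p`
on the diagonal. -/
theorem det_hankel_ne_zero {a : ℕ → ℂ} {p : ℕ} (hp : a p ≠ 0) (ha : ∀ v, p < v → a v = 0) (q : ℕ) :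
    (hankel a p q).det ≠ 0 := by
  have h1 := Matrix.det_permute' (Fin.revPerm : Equiv.Perm (Fin q)) (hankel a p q)
  have h2 : ((hankel a p q).submatrix id Fin.revPerm).det = ∏ _i : Fin q, a p := by
    rw [Matrix.det_of_isUpperTriangular]
    · refine Finset.prod_congr rfl fun i _ => ?_
      have := i.2
      simp only [hankel, Matrix.submatrix_apply, id, Matrix.of_apply, Fin.revPerm_apply, Fin.val_rev]
      rw [if_pos (by omega)]
      congr 1
      omega
    · intro i j hij
      have hij' : (j : ℕ) < i := hij
      have := j.2
      simp only [hankel, Matrix.submatrix_apply, id, Matrix.of_apply, Fin.revPerm_apply, Fin.val_rev]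
      rw [if_pos (by omega)]
      exact ha _ (by omega)
  intro h
  rw [h, mul_zero, h2] at h1
  exact Finset.prod_ne_zero_iff.2 (fun _ _ => hp) h1

/-- A polynomial as an element of `H(Ω)`. -/
noncomputable def ofPolynomial (Ω : Set ℂ) (P : ℂ[X]) : H Ω :=
  ⟨⟨fun z => P.eval (z : ℂ), by fun_prop⟩, by
    refine P.differentiable.differentiableOn.congr fun z hz => ?_
    rw [zeroExt_of_mem _ hz]
    rfl⟩

theorem zeroExt_ofPolynomial {Ω : Set ℂ} (P : ℂ[X]) {z : ℂ} (hz : z ∈ Ω) :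
    zeroExt (ofPolynomial Ω P).1 z = P.eval z :=
  zeroExt_of_mem _ hz

theorem iteratedDeriv_eval (P : ℂ[X]) (v : ℕ) :
    iteratedDeriv v (fun z => P.eval z) = fun z => (derivative^[v] P).eval z := by
  induction v with
  | zero => simp
  | succ v ih =>
    rw [iteratedDeriv_succ, ih, Function.iterate_succ_apply']
    funext z
    exact Polynomial.deriv _

theorem taylorCoeff_ofPolynomial {Ω : Set ℂ} (hΩ : IsOpen Ω) {ζ : ℂ} (hζ : ζ ∈ Ω) (P : ℂ[X])
    (v : ℕ) : taylorCoeff (ofPolynomial Ω P) ζ v = (taylor ζ P).coeff v := by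
  have h1 : zeroExt (ofPolynomial Ω P).1 =ᶠ[𝓝 ζ] fun z => P.eval z := by
    filter_upwards [hΩ.mem_nhds hζ] with z hz
    exact zeroExt_ofPolynomial P hz
  rw [taylorCoeff, h1.iteratedDeriv_eq, iteratedDeriv_eval, taylor_coeff,
    ← factorial_smul_hasseDeriv]
  have : (v.factorial : ℂ) ≠ 0 := by exact_mod_cast v.factorial_ne_zero
  simp
  field_simp

theorem ofPolynomial_mem_padeLimits {Ω : Set ℂ} (hΩ : IsOpen Ω) {ζ : ℂ} (hζ : ζ ∈ Ω)
    {F : Set (ℕ × ℕ)} {P : ℂ[X]} {p q : ℕ} (hF : (p, q) ∈ F) (hP : P.natDegree = p) (hP0 : P ≠ 0) :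
    ofPolynomial Ω P ∈ padeLimits Ω F ζ := by
  have ha : taylorCoeff (ofPolynomial Ω P) ζ = (taylor ζ P).coeff :=
    funext (taylorCoeff_ofPolynomial hΩ hζ P)
  have hdeg : (taylor ζ P).natDegree = p := by rw [natDegree_taylor, hP]
  have hD : ofPolynomial Ω P ∈ D p q ζ := by
    refine det_hankel_ne_zero ?_ (fun v hv => ?_) q
    · rw [ha, ← hdeg]
      exact leadingCoeff_ne_zero.2 fun h => hP0 ((taylor_eq_zero ζ P).1 h)
    · rw [ha]
      exact coeff_eq_zero_of_natDegree_lt (hdeg ▸ hv)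
  have hpade : IsPade (taylorCoeff (ofPolynomial Ω P) ζ) p q (taylor ζ P) 1 := by
    refine ⟨hdeg.le, by simp, by simp, (isPade_taylor_iff _ _ _ _ (by simp)).2 fun v _ => ?_⟩
    simp [ha]
  have hden : (padePair (ofPolynomial Ω P) ζ p q).2 = 1 := (padePair_isPade hD).den_eq hD hpade
  have hnum : (padePair (ofPolynomial Ω P) ζ p q).1 = taylor ζ P :=
    (padePair_isPade hD).num_eq hD hpade
  refine ⟨fun _ => p, fun _ => q, fun _ => hF, fun _ => hD, fun K hK _ =>
    ⟨Eventually.of_forall fun _ z _ => by simp [padeDen, hden], ?_⟩⟩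
  rw [Metric.tendstoUniformlyOn_iff]
  refine fun ε hε => Eventually.of_forall fun _ z hz => ?_
  rw [zeroExt_ofPolynomial P (hK hz), pade, padeDen, hden, hnum, eval_one, div_one, taylor_eval_sub,
    dist_self]
  exact hε

theorem exists_mem_padeLimits_near {Ω : Set ℂ} (hΩ : IsOpen Ω)
    (hsc : ∀ z ∈ Ω, IsSimplyConnected (connectedComponentIn Ω z)) {F : Set (ℕ × ℕ)}
    (hF : ∃ s : ℕ → ℕ × ℕ, (∀ n, s n ∈ F) ∧ Tendsto (fun n => (s n).1) atTop atTop)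
    {ζ : ℂ} (hζ : ζ ∈ Ω) (f : H Ω) {K : Set Ω} (hK : IsCompact K) {ε : ℝ} (hε : 0 < ε) :
    ∃ g ∈ padeLimits Ω F ζ, ∀ z ∈ K, ‖g.1 z - f.1 z‖ < ε := by
  have hK' : IsCompact ((↑) '' K : Set ℂ) := hK.image continuous_subtype_val
  obtain ⟨P, hP⟩ := exists_polynomial_near_of_isSimplyConnected hΩ hsc hK'
    (by rintro _ ⟨z, -, rfl⟩; exact z.2) f.2 (half_pos hε)
  obtain ⟨s, hs, hlim⟩ := hF
  -- The strict inequality fixes the degree of the perturbed polynomial and, forcing it to be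
  -- positive, makes that polynomial nonzero.
  obtain ⟨n, hn⟩ := (hlim.eventually_gt_atTop P.natDegree).exists
  obtain ⟨M, hM⟩ := hK'.exists_bound_of_continuousOn (f := fun z : ℂ => z ^ (s n).1) (by fun_prop)
  have hM1 : 0 < |M| + 1 := by positivity
  -- Keeps `d * z ^ (s n).1` below `ε / 2` on `K`; `|M| + 1` is positive even if `K` is empty and
  -- `M` negative.
  let d : ℝ := ε / 2 / (|M| + 1)
  have hd : 0 < d := by positivity
  have hd0 : (d : ℂ) ≠ 0 := by exact_mod_cast hd.ne'
  have hdeg : (P + C (d : ℂ) * X ^ (s n).1).natDegree = (s n).1 := by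
    rw [natDegree_add_eq_right_of_natDegree_lt] <;> rw [natDegree_C_mul_X_pow _ _ hd0]
    exact hn
  refine ⟨ofPolynomial Ω (P + C (d : ℂ) * X ^ (s n).1),
    ofPolynomial_mem_padeLimits hΩ hζ (q := (s n).2) (hs n) hdeg ?_, fun z hz => ?_⟩
  · intro h
    rw [h, natDegree_zero] at hdeg
    omega
  · have h1 := hP z ⟨z, hz, rfl⟩
    have h2 := hM z ⟨z, hz, rfl⟩
    rw [zeroExt_of_mem f.1 z.2] at h1
    change ‖(P + C (d : ℂ) * X ^ (s n).1).eval (z : ℂ) - f.1 z‖ < ε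
    have h3 : ‖(d : ℂ) * (z : ℂ) ^ (s n).1‖ < ε / 2 := by
      rw [norm_mul, Complex.norm_real, Real.norm_of_nonneg hd.le]
      calc d * ‖(z : ℂ) ^ (s n).1‖ ≤ d * |M| := by gcongr; exact h2.trans (le_abs_self M)
        _ < d * (|M| + 1) := by gcongr; linarith
        _ = ε / 2 := div_mul_cancel₀ _ hM1.ne'
    have h4 : (P + C (d : ℂ) * X ^ (s n).1).eval (z : ℂ) - f.1 z =
        (P.eval (z : ℂ) - f.1 z) + d * (z : ℂ) ^ (s n).1 := by
      simp only [eval_add, eval_mul, eval_C, eval_pow, eval_X]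
      ring
    rw [h4]
    exact (norm_add_le _ _).trans_lt (by linarith)

theorem dense_padeLimits {Ω : Set ℂ} (hΩ : IsOpen Ω)
    (hsc : ∀ z ∈ Ω, IsSimplyConnected (connectedComponentIn Ω z)) {F : Set (ℕ × ℕ)}
    (hF : ∃ s : ℕ → ℕ × ℕ, (∀ n, s n ∈ F) ∧ Tendsto (fun n => (s n).1) atTop atTop)
    {ζ : ℂ} (hζ : ζ ∈ Ω) : Dense (padeLimits Ω F ζ) := by
  have := hΩ.locallyCompactSpace
  intro f
  let E := CompactExhaustion.choice Ω
  choose g hg hgf using fun n : ℕ => exists_mem_padeLimits_near hΩ hsc hF hζ f (E.isCompact n)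
    (Nat.one_div_pos_of_nat (α := ℝ) (n := n))
  refine mem_closure_of_tendsto (f := g) (b := atTop) ?_ (Eventually.of_forall hg)
  rw [tendsto_subtype_rng, ContinuousMap.tendsto_iff_forall_isCompact_tendstoUniformlyOn]
  intro K hK
  obtain ⟨m, hm⟩ := E.exists_superset_of_isCompact hK
  rw [Metric.tendstoUniformlyOn_iff]
  intro ε hε
  filter_upwards [eventually_ge_atTop m,
    (tendsto_one_div_add_atTop_nhds_zero_nat (𝕜 := ℝ)).eventually_lt_const hε] with n hn hnε z hz
  rw [dist_comm, dist_eq_norm]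
  exact (hgf n z (E.subset hn (hm hz))).trans hnε

end Pade

theorem theorem3p6 (Ω : Set ℂ) (hΩ : IsOpen Ω)
    (hsc : ∀ z ∈ Ω, IsSimplyConnected (connectedComponentIn Ω z))
    (F : Set (ℕ × ℕ))
    (hF : ∃ s : ℕ → ℕ × ℕ, (∀ n, s n ∈ F) ∧ Tendsto (fun n => (s n).1) atTop atTop)
    (ζ₀ : ℂ) (hζ₀ : ζ₀ ∈ Ω) :
    (∃ f : Pade.H Ω, f ∈ Pade.padeLimits Ω F ζ₀) ∧
      IsGδ (Pade.padeLimits Ω F ζ₀) ∧ Dense (Pade.padeLimits Ω F ζ₀) := by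
  have hdense := Pade.dense_padeLimits hΩ hsc hF hζ₀
  have : Nonempty (Pade.H Ω) := ⟨Pade.ofPolynomial Ω 0⟩
  exact ⟨hdense.nonempty, Pade.isGδ_padeLimits hΩ F hζ₀, hdense⟩
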